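/- **Theorem.** Let $X$ be a spectral space, that is, a sober quasi-compact topological space whose compact open subsets are closed under finite intersections and form a basis of the topology. Let $X^p$ be the set $X$ with the patch topology, generated by the compact open subsets of $X$ and their complements, and let $\phi\colon X^p\to X$ be the (continuous) identity map. It induces an adjunction $\phi^*\colon \mathrm{Sh}(X)\leftrightarrows \mathrm{Sh}(X^p)\colon\phi_*$ between the categories of sheaves of sets; write $\varepsilon\colon\phi^*\phi_*\to 1$ for its counit and $T=\phi_*\phi^*$ for the induced monad on $\mathrm{Sh}(X)$ (the patch monad). The support of a sheaf $\mathcal G$ on $X^p$ is the set $\{x\in X^p : \mathcal G_x\neq\emptyset\}$; it is called saturated if it is an upset for the specialisation order of $X$, in which $x\le y$ means $x\in\overline{\{y\}}$ (closure in $X$). Let $\mathrm{Sh}_s(X^p)$ be the full subcategory of $\mathrm{Sh}(X^p)$ consisting of the sheaves with saturated support. Then $\phi^*$ takes values in $\mathrm{Sh}_s(X^p)$, and the restricted direct image functor $\phi_*\colon \mathrm{Sh}_s(X^p)\to\mathrm{Sh}(X)$ is monadic: it has a left adjoint, and the comparison functor to the category of algebras for the induced monad is an equivalence. In particular, the functor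 $$k\colon \mathrm{Sh}_s(X^p)\to \mathrm{Sh}(X)^T,\qquad \mathcal G\mapsto(\phi_*\mathcal G,\ \phi_*\varepsilon_{\mathcal G}),$$ is an equivalence between $\mathrm{Sh}_s(X^p)$ and the category of $T$-algebras on $\mathrm{Sh}(X)$. Moreover, the category $\mathrm{Sh}(X)^T$ of $T$-algebras is exact in the sense of Barr: it has all finite limits, every (internal) equivalence relation $R\rightrightarrows A$ has a coequaliser of which it is the kernel pair, and regular epimorphisms are stable under pullback. -/

import Mathlib

open CategoryTheory CategoryTheory.Limits TopologicalSpace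

universe v u

/-- Exact categories in the sense of Barr: all finite limits exist, every (internal) equivalence
relation `p₁, p₂ : R ⟶ A` has a coequaliser of which it is the kernel pair, and regular
epimorphisms are stable under pullback. -/
structure IsBarrExact (C : Type u) [Category.{v} C] : Prop where
  hasFiniteLimits : HasFiniteLimits C
  effective : ∀ {R A : C} (p₁ p₂ : R ⟶ A), IsEquivalenceRelation p₁ p₂ →
    ∃ (Q : C) (q : A ⟶ Q) (w : p₁ ≫ q = p₂ ≫ q),
      Nonempty (IsColimit (Cofork.ofπ q w)) ∧ IsKernelPair q p₁ p₂
  regularEpi_stable : (MorphismProperty.regularEpi C).IsStableUnderBaseChange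

namespace PatchMonad

/-- The patch space `Xᵖ`: the points of `X` with the topology that has as a subbasis the compact
open subsets of `X` and their complements. -/
abbrev patchSpace (X : TopCat.{u}) : TopCat.{u} :=
  TopCat.of (WithConstructibleTopology X)

/-- The point of `X` underlying a point of the patch space. -/
abbrev toBase (X : TopCat.{u}) (x : patchSpace X) : X :=
  WithTopology.ofTopology x

lemma continuous_toBase (X : TopCat.{u}) [SpectralSpace X] : Continuous (toBase X) := by
  refine PrespectralSpace.isTopologicalBasis.continuous_iff.mpr ?_
  rintro U ⟨hU, hU'⟩
  rw [WithConstructibleTopology.isOpen_iff]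
  exact hU'.isOpen_constructibleTopology_of_isOpen hU

/-- The continuous map `φ : Xᵖ ⟶ X` that is the identity on points. -/
def patchMap (X : TopCat.{u}) [SpectralSpace X] : patchSpace X ⟶ X :=
  TopCat.ofHom ⟨toBase X, continuous_toBase X⟩

/-- The support of a sheaf of sets: the set of points at which the stalk is non-empty. -/
def support {Y : TopCat.{u}} (G : TopCat.Sheaf (Type u) Y) : Set Y :=
  {y | Nonempty (TopCat.Presheaf.stalk G.obj y)}

/-- A sheaf on `Xᵖ` has saturated support if its support is an upset for the specialisation order
of `X`, in which `x ≤ y` means that `x` lies in the closure of `{y}` in `X`. -/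
def HasSaturatedSupport (X : TopCat.{u}) :
    ObjectProperty (TopCat.Sheaf (Type u) (patchSpace X)) :=
  fun G => ∀ x y : patchSpace X, toBase X x ∈ closure {toBase X y} →
    x ∈ support G → y ∈ support G

/-- The category `Sh_s(Xᵖ)` of sheaves of sets on `Xᵖ` with saturated support, a full subcategory
of the category of all sheaves of sets on `Xᵖ`. -/
abbrev SaturatedSheaf (X : TopCat.{u}) : Type (u + 1) :=
  (HasSaturatedSupport X).FullSubcategory

/-- The adjunction `φ^* ⊣ φ_*` between sheaves on `X` and sheaves on `Xᵖ`. -/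
noncomputable def patchAdjunction (X : TopCat.{u}) [SpectralSpace X] :
    TopCat.Sheaf.pullback (Type u) (patchMap X) ⊣ TopCat.Sheaf.pushforward (Type u) (patchMap X) :=
  TopCat.Sheaf.pullbackPushforwardAdjunction (Type u) (patchMap X)

/-- The patch monad `T = φ_* φ^*` on the category of sheaves on `X`. -/
noncomputable def patchMonad (X : TopCat.{u}) [SpectralSpace X] :
    Monad (TopCat.Sheaf (Type u) X) :=
  (patchAdjunction X).toMonad

/-- The restriction of the direct image functor `φ_*` to sheaves with saturated support. -/
noncomputable def directImage (X : TopCat.{u}) [SpectralSpace X] :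
    SaturatedSheaf X ⥤ TopCat.Sheaf (Type u) X :=
  (HasSaturatedSupport X).ι ⋙ TopCat.Sheaf.pushforward (Type u) (patchMap X)

/-- The comparison functor `k`, which takes a sheaf `G` with saturated support to the `T`-algebra
`(φ_* G, φ_* ε_G)`, where `ε` is the counit of `φ^* ⊣ φ_*`. -/
noncomputable def comparison (X : TopCat.{u}) [SpectralSpace X] :
    SaturatedSheaf X ⥤ (patchMonad X).Algebra :=
  (HasSaturatedSupport X).ι ⋙ Monad.comparison (patchAdjunction X)

end PatchMonad

/-! The argument applies Beck's monadicity theorem in its reflexive form: a right adjoint is monadic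
if it reflects isomorphisms and its source has reflexive coequalisers which it preserves.

Preservation: clopen sets form a basis of `Xᵖ`, and a compact open `V` of `X` has compact clopen
preimage there. Over a compact open set, local data can be refined to finitely many disjoint clopen
pieces and glued without compatibility conditions. Hence epimorphisms are surjective on such
sections (`app_surjective_of_epi`), and identifications in a reflexive coequaliser come from finite
chains (`eqvGen_of_isColimit_cofork`). Compact opens form a basis of `X`, so `φ_*` preserves
reflexive coequalisers.

Reflection: the compact open neighbourhoods of `x` in `X` intersect in the generisations of `x`. If
`x` lies in a saturated support, compactness puts one such neighbourhood inside the support. There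
is a section over its preimage, into which any germ at `x` can be spliced, so `φ_* G` sees all
stalks of `G`.

Exactness: `T = φ_* φ^*` preserves reflexive coequalisers, so the forgetful functor creates them,
and exactness of sheaves on `X` lifts to algebras. -/

/-! ### Sections, germs and coequalisers of sheaves of sets -/

section Sections

open Opposite TopCat

variable {Y : TopCat.{u}}

namespace TopCat.Presheaf

/-- Restriction of a section of a presheaf of types to a smaller open set. -/
def res (F : Y.Presheaf (Type u)) {U V : Opens Y} (h : V ≤ U) (s : F.obj (op U)) :
    F.obj (op V) :=
  F.map (homOfLE h).op s

@[simp]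
lemma res_res (F : Y.Presheaf (Type u)) {U V W : Opens Y} (h : V ≤ U) (h' : W ≤ V)
    (s : F.obj (op U)) : F.res h' (F.res h s) = F.res (h'.trans h) s := by
  simp only [res, ← ConcreteCategory.comp_apply, ← F.map_comp]
  rfl

@[simp]
lemma res_self (F : Y.Presheaf (Type u)) {U : Opens Y} (s : F.obj (op U)) :
    F.res le_rfl s = s := by
  have : (homOfLE (le_refl U)).op = 𝟙 (op U) := rfl
  simp only [res, this, F.map_id]
  rfl

lemma app_res {F G : Y.Presheaf (Type u)} (f : F ⟶ G) {U V : Opens Y} (h : V ≤ U)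
    (s : F.obj (op U)) : f.app (op V) (F.res h s) = G.res h (f.app (op U) s) :=
  NatTrans.naturality_apply f (homOfLE h).op s

lemma germ_res_eq (F : Y.Presheaf (Type u)) {U V : Opens Y} (h : V ≤ U) {x : Y} (hx : x ∈ V)
    (s : F.obj (op U)) : F.germ V x hx (F.res h s) = F.germ U x (h hx) s :=
  F.germ_res_apply (homOfLE h) x hx s

lemma exists_res_eq_of_germ_eq (F : Y.Presheaf (Type u)) {U V : Opens Y} {x : Y} (hU : x ∈ U)
    (hV : x ∈ V) {s : F.obj (op U)} {t : F.obj (op V)}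
    (h : F.germ U x hU s = F.germ V x hV t) :
    ∃ (W : Opens Y) (_ : x ∈ W) (h₁ : W ≤ U) (h₂ : W ≤ V), F.res h₁ s = F.res h₂ t := by
  obtain ⟨W, hW, i, j, e⟩ := F.germ_eq x hU hV s t h
  exact ⟨W, hW, i.le, j.le, e⟩

end TopCat.Presheaf

namespace TopCat.Sheaf

lemma eq_of_sup (F : Sheaf (Type u) Y) {U V W : Opens Y} (hU : U ≤ W) (hV : V ≤ W)
    (hW : W ≤ U ⊔ V) {s t : F.obj.obj (op W)} (h₁ : F.presheaf.res hU s = F.presheaf.res hU t)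
    (h₂ : F.presheaf.res hV s = F.presheaf.res hV t) : s = t :=
  F.eq_of_locally_eq₂ (homOfLE hU) (homOfLE hV) hW s t h₁ h₂

lemma eq_of_forall_mem (F : Sheaf (Type u) Y) {U : Opens Y} {s t : F.obj.obj (op U)}
    (h : ∀ x ∈ U, ∃ (V : Opens Y) (hV : V ≤ U), x ∈ V ∧ F.presheaf.res hV s = F.presheaf.res hV t) :
    s = t := by
  refine Presheaf.section_ext F U s t fun x hx ↦ ?_
  obtain ⟨V, hV, hxV, e⟩ := h x hx
  rw [← F.presheaf.germ_res_eq hV hxV, ← F.presheaf.germ_res_eq hV hxV, e]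

lemma subsingleton_of_eq_bot (F : Sheaf (Type u) Y) {U : Opens Y} (hU : U = ⊥)
    (s t : F.obj.obj (op U)) : s = t :=
  F.eq_of_forall_mem fun x hx ↦ by simp [hU] at hx

lemma nonempty_of_eq_bot (F : Sheaf (Type u) Y) {U : Opens Y} (hU : U = ⊥) :
    Nonempty (F.obj.obj (op U)) := by
  obtain ⟨r, -, -⟩ := F.existsUnique_gluing' (fun i : Empty ↦ i.elim) U (fun i ↦ i.elim)
    (by simp [hU]) (fun i ↦ i.elim) (fun i ↦ i.elim)
  exact ⟨r⟩

lemma exists_glue (F : Sheaf (Type u) Y) {U V : Opens Y} (h : Disjoint U V)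
    (s : F.obj.obj (op U)) (t : F.obj.obj (op V)) :
    ∃ r : F.obj.obj (op (U ⊔ V)),
      F.presheaf.res le_sup_left r = s ∧ F.presheaf.res le_sup_right r = t := by
  let W : Bool → Opens Y := fun b ↦ Bool.rec V U b
  let σ : ∀ b, F.obj.obj (op (W b)) := fun b ↦ Bool.rec t s b
  have hW : ∀ b, W b ≤ U ⊔ V := by rintro (_ | _); exacts [le_sup_right, le_sup_left]
  obtain ⟨r, hr, -⟩ := F.existsUnique_gluing' W (U ⊔ V) (fun b ↦ homOfLE (hW b))
    (sup_le (le_iSup W true) (le_iSup W false)) σ (by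
      rintro (_ | _) (_ | _)
      · rfl
      · exact F.subsingleton_of_eq_bot (by simpa [W, inf_comm] using h.eq_bot) _ _
      · exact F.subsingleton_of_eq_bot (by simpa [W] using h.eq_bot) _ _
      · rfl)
  exact ⟨r, hr true, hr false⟩

lemma exists_glue' (F : Sheaf (Type u) Y) {U V W : Opens Y} (h : Disjoint U V) (hU : U ≤ W)
    (hV : V ≤ W) (hW : W ≤ U ⊔ V) (s : F.obj.obj (op U)) (t : F.obj.obj (op V)) :
    ∃ r : F.obj.obj (op W), F.presheaf.res hU r = s ∧ F.presheaf.res hV r = t := by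
  obtain rfl : W = U ⊔ V := le_antisymm hW (sup_le hU hV)
  exact F.exists_glue h s t

/-- The relation on the sections over `U` given by a pair of morphisms of sheaves. -/
def Rel {R G : Sheaf (Type u) Y} (f g : R ⟶ G) (U : Opens Y) (a b : G.obj.obj (op U)) : Prop :=
  ∃ r : R.obj.obj (op U), f.hom.app (op U) r = a ∧ g.hom.app (op U) r = b

lemma Rel.res {R G : Sheaf (Type u) Y} {f g : R ⟶ G} {U V : Opens Y} (h : V ≤ U)
    {a b : G.obj.obj (op U)} (hab : Rel f g U a b) :
    Rel f g V (G.presheaf.res h a) (G.presheaf.res h b) := by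
  obtain ⟨r, rfl, rfl⟩ := hab
  exact ⟨R.presheaf.res h r, Presheaf.app_res _ _ _, Presheaf.app_res _ _ _⟩

lemma eqvGen_rel_res {R G : Sheaf (Type u) Y} {f g : R ⟶ G} {U V : Opens Y} (h : V ≤ U)
    {a b : G.obj.obj (op U)} (hab : Relation.EqvGen (Rel f g U) a b) :
    Relation.EqvGen (Rel f g V) (G.presheaf.res h a) (G.presheaf.res h b) := by
  induction hab with
  | rel _ _ h' => exact .rel _ _ (h'.res h)
  | refl => exact .refl _
  | symm _ _ _ ih => exact .symm _ _ ih
  | trans _ _ _ _ _ ih ih' => exact .trans _ _ _ ih ih'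

/-- The explicit quotient by the relation also coequalises the pair, so `Quot.mk` factors through
`q`. -/
lemma _root_.CategoryTheory.Limits.Types.eqvGen_of_isColimit_cofork {R A Q : Type u}
    {f g : R ⟶ A} {q : A ⟶ Q} {w : f ≫ q = g ≫ q} (hq : IsColimit (Cofork.ofπ q w)) {a b : A}
    (h : q a = q b) : Relation.EqvGen (fun a b ↦ ∃ r, f r = a ∧ g r = b) a b := by
  let ρ : A → A → Prop := fun a b ↦ ∃ r, f r = a ∧ g r = b
  have hw : f ≫ (↾(Quot.mk ρ)) = g ≫ (↾(Quot.mk ρ)) := by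
    ext r
    exact Quot.sound ⟨r, rfl, rfl⟩
  obtain ⟨l, hl⟩ := Cofork.IsColimit.desc' hq _ hw
  have key : ∀ a, l (q a) = Quot.mk ρ a := fun a ↦ ConcreteCategory.congr_hom hl a
  exact Quot.eqvGen_exact (by rw [← key, ← key, h])

/-- A chain of related germs is finite, and each link spreads out to a neighbourhood of `x`. -/
lemma exists_eqvGen_res_of_germ {R G : Sheaf (Type u) Y} {f g : R ⟶ G} {x : Y}
    {α β : G.presheaf.stalk x}
    (h : Relation.EqvGen (fun α β ↦ ∃ r, (Presheaf.stalkFunctor _ x).map f.hom r = α ∧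
      (Presheaf.stalkFunctor _ x).map g.hom r = β) α β)
    {U V : Opens Y} (hU : x ∈ U) (hV : x ∈ V) (a : G.obj.obj (op U)) (b : G.obj.obj (op V))
    (ha : G.presheaf.germ U x hU a = α) (hb : G.presheaf.germ V x hV b = β) :
    ∃ (W : Opens Y) (_ : x ∈ W) (h₁ : W ≤ U) (h₂ : W ≤ V),
      Relation.EqvGen (Rel f g W) (G.presheaf.res h₁ a) (G.presheaf.res h₂ b) := by
  induction h generalizing U V with
  | rel α β h =>
    obtain ⟨r, hr₁, hr₂⟩ := h
    obtain ⟨W, hW, r, rfl⟩ := R.presheaf.exists_germ_eq r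
    rw [Presheaf.stalkFunctor_map_germ_apply] at hr₁ hr₂
    obtain ⟨W₁, hx₁, i₁, j₁, e₁⟩ := G.presheaf.exists_res_eq_of_germ_eq _ _ (hr₁.trans ha.symm)
    obtain ⟨W₂, hx₂, i₂, j₂, e₂⟩ := G.presheaf.exists_res_eq_of_germ_eq _ _ (hr₂.trans hb.symm)
    refine ⟨W₁ ⊓ W₂, ⟨hx₁, hx₂⟩, inf_le_left.trans j₁, inf_le_right.trans j₂, .rel _ _
      ⟨R.presheaf.res (inf_le_left.trans i₁) r, ?_, ?_⟩⟩
    · rw [Presheaf.app_res, ← G.presheaf.res_res i₁ inf_le_left, e₁, G.presheaf.res_res]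
    · rw [Presheaf.app_res, ← G.presheaf.res_res i₂ inf_le_right, e₂, G.presheaf.res_res]
  | refl α =>
    obtain ⟨W, hx, i, j, e⟩ := G.presheaf.exists_res_eq_of_germ_eq _ _ (ha.trans hb.symm)
    exact ⟨W, hx, i, j, e ▸ .refl _⟩
  | symm α β _ ih =>
    obtain ⟨W, hx, i, j, e⟩ := ih hV hU b a hb ha
    exact ⟨W, hx, j, i, e.symm⟩
  | trans α β γ _ _ ih ih' =>
    obtain ⟨W, hW, c, rfl⟩ := G.presheaf.exists_germ_eq β
    obtain ⟨W₁, hx₁, i₁, j₁, e₁⟩ := ih hU hW a c ha rfl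
    obtain ⟨W₂, hx₂, i₂, j₂, e₂⟩ := ih' hW hV c b rfl hb
    refine ⟨W₁ ⊓ W₂, ⟨hx₁, hx₂⟩, inf_le_left.trans i₁, inf_le_right.trans j₂, ?_⟩
    have e₁' := eqvGen_rel_res (inf_le_left : W₁ ⊓ W₂ ≤ W₁) e₁
    have e₂' := eqvGen_rel_res (inf_le_right : W₁ ⊓ W₂ ≤ W₂) e₂
    rw [G.presheaf.res_res, G.presheaf.res_res] at e₁' e₂'
    exact e₁'.trans _ _ _ e₂'

/-- Two sections that become equal in the coequalizer of a pair of morphisms of sheaves are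
locally related by the equivalence relation that the pair generates. -/
lemma exists_eqvGen_of_isColimit_cofork {R G Q : Sheaf (Type u) Y} {f g : R ⟶ G} {q : G ⟶ Q}
    {w : f ≫ q = g ≫ q} (hq : IsColimit (Cofork.ofπ q w)) {U : Opens Y}
    {a b : G.obj.obj (op U)} (hab : q.hom.app (op U) a = q.hom.app (op U) b) {x : Y}
    (hx : x ∈ U) :
    ∃ (V : Opens Y) (_ : x ∈ V) (h : V ≤ U),
      Relation.EqvGen (Rel f g V) (G.presheaf.res h a) (G.presheaf.res h b) := by
  classical
  -- The stalk functor is left adjoint to the skyscraper sheaf, so the question passes to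
  -- coequalisers of sets.
  have : PreservesColimitsOfSize.{0, 0} (Sheaf.forget (Type u) Y ⋙ Presheaf.stalkFunctor _ x) :=
    (stalkSkyscraperSheafAdjunction (C := Type u) x).leftAdjoint_preservesColimits
  have hq' := isColimitCoforkMapOfIsColimit (Sheaf.forget (Type u) Y ⋙ Presheaf.stalkFunctor _ x)
    w hq
  have h := Types.eqvGen_of_isColimit_cofork hq' (a := G.presheaf.germ U x hx a)
    (b := G.presheaf.germ U x hx b) (by
      change (Presheaf.stalkFunctor _ x).map q.hom _ = (Presheaf.stalkFunctor _ x).map q.hom _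
      rw [Presheaf.stalkFunctor_map_germ_apply, Presheaf.stalkFunctor_map_germ_apply, hab])
  obtain ⟨W, hW, i, j, e⟩ := exists_eqvGen_res_of_germ h hx hx a b rfl rfl
  exact ⟨W, hW, i, e⟩

lemma epi_iff {F G : Sheaf (Type u) Y} (f : F ⟶ G) :
    Epi f ↔ ∀ (U : Opens Y) (t : G.obj.obj (op U)), ∀ x ∈ U, ∃ (V : Opens Y) (h : V ≤ U),
      (∃ s, f.hom.app (op V) s = G.presheaf.res h t) ∧ x ∈ V := by
  rw [← Sheaf.isLocallySurjective_iff_epi, Presheaf.isLocallySurjective_iff]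
  rfl

end TopCat.Sheaf

end Sections

/-! ### Gluing over compact open sets in the presence of a clopen basis -/

section Clopen

open Opposite TopCat

/-- In a space with a basis of clopen sets, a property of open subsets of a compact open set `K`
that holds locally and passes to smaller open sets and to disjoint unions of clopen sets holds for
`K`. -/
lemma TopologicalSpace.IsTopologicalBasis.compact_open_induction {Y : Type*} [TopologicalSpace Y]
    (hY : IsTopologicalBasis {s : Set Y | IsClopen s}) {K : Opens Y}
    (hK : IsCompact (K : Set Y)) {P : ∀ U : Opens Y, U ≤ K → Prop}
    (mono : ∀ U V (hV : V ≤ U) (hU : U ≤ K), P U hU → P V (hV.trans hU)) (bot : P ⊥ bot_le)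
    (sup : ∀ (U V : Opens Y) (hU : U ≤ K) (hV : V ≤ K), Disjoint U V →
      P U hU → P V hV → P (U ⊔ V) (sup_le hU hV))
    (loc : ∀ x ∈ K, ∃ (V : Opens Y) (hV : V ≤ K), x ∈ V ∧ P V hV) :
    P K le_rfl := by
  obtain ⟨W, hWK, -, hKW, hW⟩ := hK.induction_on
    (p := fun s ↦ ∃ (W : Opens Y) (hW : W ≤ K), IsClopen (W : Set Y) ∧ s ⊆ W ∧ P W hW)
    ⟨⊥, bot_le, isClopen_empty, by simp, bot⟩
    (fun s t hst ⟨W, h, h₁, h₂, h₃⟩ ↦ ⟨W, h, h₁, hst.trans h₂, h₃⟩)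
    (fun s t ⟨W, h, h₁, h₂, h₃⟩ ⟨W', h', h₁', h₂', h₃'⟩ ↦ by
      -- Clopen pieces may overlap; removing `W` from `W'` leaves a clopen set and makes the union
      -- disjoint.
      let D : Opens Y := ⟨W' \ W, (h₁'.diff h₁).isOpen⟩
      have hD : IsClopen (D : Set Y) := h₁'.diff h₁
      have hDW : D ≤ W' := Set.sdiff_subset
      refine ⟨W ⊔ D, sup_le h (hDW.trans h'), h₁.union hD, ?_,
        sup W D h (hDW.trans h') ?_ h₃ (mono W' D hDW h' h₃')⟩
      · rw [Opens.coe_sup]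
        exact (Set.union_subset_union h₂ h₂').trans Set.union_sdiff_self.symm.subset
      · rw [disjoint_iff]
        ext1
        exact Set.inter_sdiff_self _ _)
    (fun x hx ↦ by
      obtain ⟨V, hVK, hxV, hV⟩ := loc x hx
      obtain ⟨W, hW, hxW, hWV⟩ := hY.exists_subset_of_mem_open hxV V.isOpen
      exact ⟨W, mem_nhdsWithin_of_mem_nhds (hW.isOpen.mem_nhds hxW), ⟨W, hW.isOpen⟩,
        hWV.trans hVK, hW, subset_rfl, mono V ⟨W, hW.isOpen⟩ hWV hVK hV⟩)
  exact mono W K hKW hWK hW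

namespace PatchMonad

variable (X : TopCat.{u}) [SpectralSpace X]

lemma isClopen_preimage_toBase {U : Set X} (hU : IsOpen U) (hU' : IsCompact U) :
    IsClopen (toBase X ⁻¹' U) := by
  refine ⟨⟨?_⟩, hU.preimage (continuous_toBase X)⟩
  rw [WithConstructibleTopology.isOpen_iff]
  exact IsCompact.isOpen_constructibleTopology_of_isClosed (s := Uᶜ) (by simpa) hU.isClosed_compl

lemma isTopologicalBasis_isClopen :
    IsTopologicalBasis {s : Set (patchSpace X) | IsClopen s} := by
  refine isTopologicalBasis_of_isOpen_of_nhds (fun s hs ↦ hs.isOpen) fun x V hx hV ↦ ?_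
  rw [WithConstructibleTopology.isOpen_iff] at hV
  have hb := @isTopologicalBasis_of_subbasis X (constructibleTopology X)
    (constructibleTopologySubbasis X) rfl
  obtain ⟨_, ⟨S, ⟨hS, hS'⟩, rfl⟩, hxS, hSV⟩ :=
    @IsTopologicalBasis.exists_subset_of_mem_open X (constructibleTopology X) _ hb (toBase X x) _
      hx hV
  refine ⟨toBase X ⁻¹' (⋂₀ S), ?_, hxS, fun y hy ↦ hSV hy⟩
  rw [Set.preimage_sInter]
  refine hS.isClopen_biInter fun s hs ↦ ?_
  obtain h | h := hS' hs
  · exact isClopen_preimage_toBase X h.1 h.2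
  · have := (isClopen_preimage_toBase X h.1.isOpen_compl h.2).compl
    rwa [← Set.preimage_compl, compl_compl] at this

end PatchMonad

namespace TopCat.Sheaf

variable {Y : TopCat.{u}}

/-- An epimorphism of sheaves is surjective on compact open sets if the clopen sets form a basis. -/
lemma app_surjective_of_epi (hY : IsTopologicalBasis {s : Set Y | IsClopen s})
    {F G : Sheaf (Type u) Y} (f : F ⟶ G) [Epi f] {K : Opens Y}
    (hK : IsCompact (K : Set Y)) : Function.Surjective (f.hom.app (op K)) := by
  intro t
  suffices ∃ s, f.hom.app (op K) s = G.presheaf.res le_rfl t by simpa using this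
  refine hY.compact_open_induction hK
    (P := fun V h ↦ ∃ s, f.hom.app (op V) s = G.presheaf.res h t)
    (fun U V hVU hU ⟨s, hs⟩ ↦ ?_) ?_ (fun U V hU hV hUV ⟨s₁, e₁⟩ ⟨s₂, e₂⟩ ↦ ?_) (fun x hx ↦ ?_)
  · exact ⟨F.presheaf.res hVU s, by rw [Presheaf.app_res, hs, Presheaf.res_res]⟩
  · obtain ⟨s⟩ := F.nonempty_of_eq_bot rfl
    exact ⟨s, G.subsingleton_of_eq_bot rfl _ _⟩
  · obtain ⟨s, rfl, rfl⟩ := F.exists_glue hUV s₁ s₂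
    rw [Presheaf.app_res] at e₁ e₂
    exact ⟨s, G.eq_of_sup le_sup_left le_sup_right le_rfl (by simp [e₁]) (by simp [e₂])⟩
  · obtain ⟨V, hV, ⟨s, hs⟩, hxV⟩ := (epi_iff f).1 inferInstance K t x hx
    exact ⟨V, hV, hxV, s, hs⟩

/-- A sheaf with non-empty stalks at the points of a compact open set has a section over it if the
clopen sets form a basis. -/
lemma nonempty_of_nonempty_stalk (hY : IsTopologicalBasis {s : Set Y | IsClopen s})
    (F : Sheaf (Type u) Y) {K : Opens Y} (hK : IsCompact (K : Set Y))
    (h : ∀ x ∈ K, Nonempty (F.presheaf.stalk x)) : Nonempty (F.obj.obj (op K)) := by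
  refine hY.compact_open_induction hK (P := fun V _ ↦ Nonempty (F.obj.obj (op V)))
    (fun U V hVU _ ⟨s⟩ ↦ ⟨F.presheaf.res hVU s⟩) (F.nonempty_of_eq_bot rfl)
    (fun U V _ _ hUV ⟨s⟩ ⟨t⟩ ↦ ⟨(F.exists_glue hUV s t).choose⟩) fun x hx ↦ ?_
  obtain ⟨α⟩ := h x hx
  obtain ⟨V, hV, s, -⟩ := F.presheaf.exists_germ_eq α
  exact ⟨V ⊓ K, inf_le_right, ⟨hV, hx⟩, ⟨F.presheaf.res inf_le_left s⟩⟩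

/-- Reflexivity is what allows a chain over `U` to be extended to `W`: each link is glued to the
value over `V` of the common section, so the chain stays constant there. -/
lemma eqvGen_rel_glue {R G : Sheaf (Type u) Y} {f g : R ⟶ G} [IsReflexivePair f g]
    {U V W : Opens Y} (hUV : Disjoint U V) (hU : U ≤ W) (hV : V ≤ W) (hW : W ≤ U ⊔ V)
    {a b : G.obj.obj (op W)}
    (h : Relation.EqvGen (Rel f g U) (G.presheaf.res hU a) (G.presheaf.res hU b))
    (h' : G.presheaf.res hV a = G.presheaf.res hV b) :
    Relation.EqvGen (Rel f g W) a b := by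
  generalize ha : G.presheaf.res hU a = a₁ at h
  generalize hb : G.presheaf.res hU b = b₁ at h
  induction h generalizing a b with
  | rel a₁ b₁ h =>
    obtain ⟨r, rfl, rfl⟩ := h
    have hf : ∀ c, f.hom.app (op V) ((commonSection f g).hom.app (op V) c) = c := fun c ↦
      ConcreteCategory.congr_hom (congr_app (congr_arg (·.hom) (section_comp_left f g)) (op V)) c
    have hg : ∀ c, g.hom.app (op V) ((commonSection f g).hom.app (op V) c) = c := fun c ↦
      ConcreteCategory.congr_hom (congr_app (congr_arg (·.hom) (section_comp_right f g)) (op V)) c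
    obtain ⟨r', h₁, h₂⟩ := R.exists_glue' hUV hU hV hW r
      ((commonSection f g).hom.app (op V) (G.presheaf.res hV a))
    refine .rel _ _ ⟨r', ?_, ?_⟩
    · refine G.eq_of_sup hU hV hW ?_ ?_
      · rw [← Presheaf.app_res, h₁, ha]
      · rw [← Presheaf.app_res, h₂, hf]
    · refine G.eq_of_sup hU hV hW ?_ ?_
      · rw [← Presheaf.app_res, h₁, hb]
      · rw [← Presheaf.app_res, h₂, hg, h']
  | refl a₁ =>
    rw [G.eq_of_sup hU hV hW (ha.trans hb.symm) h']
    exact .refl _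
  | symm a₁ b₁ _ ih => exact .symm _ _ (ih h'.symm hb ha)
  | trans a₁ b₁ c₁ _ _ ih ih' =>
    obtain ⟨c, hc, hc'⟩ := G.exists_glue' hUV hU hV hW b₁ (G.presheaf.res hV a)
    exact .trans _ _ _ (ih hc'.symm ha hc) (ih' (hc'.trans h') hc hb)

/-- Over a compact open set, two sections with the same image in the coequalizer of a reflexive
pair of morphisms are related by the equivalence relation that the pair generates, if the clopen
sets form a basis. -/
lemma eqvGen_of_isColimit_cofork (hY : IsTopologicalBasis {s : Set Y | IsClopen s})
    {R G Q : Sheaf (Type u) Y} {f g : R ⟶ G} [IsReflexivePair f g] {q : G ⟶ Q}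
    {w : f ≫ q = g ≫ q} (hq : IsColimit (Cofork.ofπ q w)) {K : Opens Y}
    (hK : IsCompact (K : Set Y)) {a b : G.obj.obj (op K)}
    (hab : q.hom.app (op K) a = q.hom.app (op K) b) : Relation.EqvGen (Rel f g K) a b := by
  suffices Relation.EqvGen (Rel f g K) (G.presheaf.res le_rfl a) (G.presheaf.res le_rfl b) by
    simpa using this
  refine hY.compact_open_induction hK
    (P := fun V h ↦ Relation.EqvGen (Rel f g V) (G.presheaf.res h a) (G.presheaf.res h b))
    (fun U V hVU hU h ↦ ?_) ?_ (fun U V hU hV hUV h₁ h₂ ↦ ?_) (fun x hx ↦ ?_)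
  · simpa using eqvGen_rel_res hVU h
  · rw [G.subsingleton_of_eq_bot rfl (G.presheaf.res bot_le a) (G.presheaf.res bot_le b)]
    exact .refl _
  -- The chains over `U` and `V` may differ in length, so they are run one after the other, through
  -- the section `c` equal to `b` on `U` and `a` on `V`.
  · obtain ⟨c, hc, hc'⟩ := G.exists_glue hUV (G.presheaf.res hU b)
      (G.presheaf.res hV a)
    refine .trans _ c _ (eqvGen_rel_glue hUV le_sup_left le_sup_right le_rfl ?_ ?_)
      (eqvGen_rel_glue hUV.symm le_sup_right le_sup_left (sup_comm U V).le ?_ ?_)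
    · rw [hc]
      simpa using h₁
    · simp [hc']
    · rw [hc']
      simpa using h₂
    · simp [hc]
  · obtain ⟨V, hxV, hVK, h⟩ := exists_eqvGen_of_isColimit_cofork hq hab hx
    exact ⟨V, hVK, hxV, h⟩

end TopCat.Sheaf

end Clopen

namespace CategoryTheory

lemma IsReflexivePair.map {C D : Type*} [Category* C] [Category* D] {A B : C} (f g : A ⟶ B)
    [IsReflexivePair f g] (F : C ⥤ D) : IsReflexivePair (F.map f) (F.map g) :=
  .mk' (F.map (commonSection f g)) (by rw [← F.map_comp, section_comp_left, F.map_id])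
    (by rw [← F.map_comp, section_comp_right, F.map_id])

lemma Monad.preservesColimit_of_isReflexivePair {C D : Type*} [Category.{v} C] [Category.{v} D]
    (F : C ⥤ D) [Monad.PreservesColimitOfIsReflexivePair F] (K : WalkingParallelPair ⥤ C)
    (hK : IsReflexivePair (K.map .left) (K.map .right)) : PreservesColimit K F :=
  preservesColimit_of_iso_diagram F (diagramIsoParallelPair K).symm

end CategoryTheory

/-! ### Direct image along the patch map preserves reflexive coequalisers -/

section Pushforward

open Opposite TopCat

namespace TopCat.Sheaf

variable {Y : TopCat.{u}}

instance : IsRegularEpiCategory (Sheaf (Type u) Y) :=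
  inferInstanceAs (IsRegularEpiCategory
    (CategoryTheory.Sheaf (Opens.grothendieckTopology Y) (Type u)))

instance : Balanced (Sheaf (Type u) Y) :=
  inferInstanceAs (Balanced (CategoryTheory.Sheaf (Opens.grothendieckTopology Y) (Type u)))

instance : HasColimitsOfSize.{0, 0} (Sheaf (Type u) Y) :=
  inferInstanceAs (HasColimitsOfSize.{0, 0}
    (CategoryTheory.Sheaf (Opens.grothendieckTopology Y) (Type u)))

lemma comp_app_apply {F G H : Sheaf (Type u) Y} (f : F ⟶ G) (g : G ⟶ H) (U : Opens Y)
    (s : F.obj.obj (op U)) :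
    (f ≫ g).hom.app (op U) s = g.hom.app (op U) (f.hom.app (op U) s) := rfl

lemma hom_ext_apply {F G : Sheaf (Type u) Y} {f g : F ⟶ G}
    (h : ∀ (U : Opens Y) (s : F.obj.obj (op U)), f.hom.app (op U) s = g.hom.app (op U) s) :
    f = g := by
  refine InducedCategory.hom_ext ?_
  ext U s
  exact h U.unop s

/-- An epimorphism of sheaves is regular; `hp` is applied to the two images of a section under the
pair that `p` coequalises. -/
lemma exists_comp_eq_of_epi {A B Z : Sheaf (Type u) Y} (p : A ⟶ B) [Epi p] (h : A ⟶ Z)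
    (hp : ∀ (U : Opens Y) (a b : A.obj.obj (op U)), p.hom.app (op U) a = p.hom.app (op U) b →
      h.hom.app (op U) a = h.hom.app (op U) b) : ∃ l : B ⟶ Z, p ≫ l = h := by
  have : IsRegularEpi p := IsRegularEpiCategory.regularEpiOfEpi p
  refine ⟨IsRegularEpi.desc p h (hom_ext_apply fun U s ↦ hp U _ _ ?_), IsRegularEpi.fac p h _⟩
  exact ConcreteCategory.congr_hom (congr_app (congr_arg (·.hom) (IsRegularEpi.w p)) (op U)) s

end TopCat.Sheaf

namespace PatchMonad

open TopCat.Sheaf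

variable (X : TopCat.{u}) [SpectralSpace X]

lemma exists_isCompact_le {U : Opens X} {x : X} (hx : x ∈ U) :
    ∃ V : Opens X, V ≤ U ∧ x ∈ V ∧ IsCompact (V : Set X) := by
  obtain ⟨V, ⟨hV, hV'⟩, hxV, hVU⟩ :=
    PrespectralSpace.isTopologicalBasis.exists_subset_of_mem_open hx U.isOpen
  exact ⟨⟨V, hV⟩, hVU, hxV, hV'⟩

lemma isClopen_map_patchMap {V : Opens X} (hV : IsCompact (V : Set X)) :
    IsClopen ((Opens.map (patchMap X)).obj V : Set (patchSpace X)) :=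
  isClopen_preimage_toBase X V.isOpen hV

lemma isCompact_map_patchMap {V : Opens X} (hV : IsCompact (V : Set X)) :
    IsCompact ((Opens.map (patchMap X)).obj V : Set (patchSpace X)) :=
  (isClopen_map_patchMap X hV).isClosed.isCompact

instance pushforward_preservesEpimorphisms :
    (TopCat.Sheaf.pushforward (Type u) (patchMap X)).PreservesEpimorphisms where
  preserves {F G} f _ := by
    refine (epi_iff _).2 fun U t x hx ↦ ?_
    obtain ⟨V, hVU, hxV, hV⟩ := exists_isCompact_le X hx
    exact ⟨V, hVU, app_surjective_of_epi (isTopologicalBasis_isClopen X) f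
      (isCompact_map_patchMap X hV) _, hxV⟩

/-- The direct image of sheaves along `Xᵖ ⟶ X` preserves reflexive coequalizers. -/
instance pushforward_preservesColimit_of_isReflexivePair :
    Monad.PreservesColimitOfIsReflexivePair
      (TopCat.Sheaf.pushforward (Type u) (patchMap X)) where
  out R G f g _ := by
    refine preservesColimit_of_preserves_colimit_cocone (coequalizerIsCoequalizer f g) ?_
    refine (isColimitMapCoconeCoforkEquiv _ _).symm ?_
    set P := TopCat.Sheaf.pushforward (Type u) (patchMap X)
    refine Cofork.IsColimit.mk' _ fun s ↦ ?_
    have : Epi (P.map (coequalizer.π f g)) := inferInstance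
    have h := exists_comp_eq_of_epi (P.map (coequalizer.π f g)) s.π fun U a b hab ↦ ?_
    · exact ⟨h.choose, h.choose_spec, fun {m} hm ↦
        (cancel_epi (P.map (coequalizer.π f g))).1 (Eq.trans hm h.choose_spec.symm)⟩
    refine s.pt.eq_of_forall_mem fun x hx ↦ ?_
    obtain ⟨V, hVU, hxV, hV⟩ := exists_isCompact_le X hx
    refine ⟨V, hVU, hxV, ?_⟩
    rw [← Presheaf.app_res, ← Presheaf.app_res]
    -- Over a compact open `V` the identification is a finite chain, and `s.π` is constant along
    -- every link.
    have key := eqvGen_of_isColimit_cofork (isTopologicalBasis_isClopen X)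
      (coequalizerIsCoequalizer f g) (isCompact_map_patchMap X hV)
      (a := (P.obj G).presheaf.res hVU a) (b := (P.obj G).presheaf.res hVU b)
      (by
        have := congr_arg ((P.obj (coequalizer f g)).presheaf.res hVU) hab
        rwa [← Presheaf.app_res, ← Presheaf.app_res] at this)
    generalize (P.obj G).presheaf.res hVU a = a', (P.obj G).presheaf.res hVU b = b' at key ⊢
    induction key with
    | rel _ _ h =>
      obtain ⟨r, rfl, rfl⟩ := h
      exact ConcreteCategory.congr_hom (congr_app (congr_arg (·.hom) s.condition) (op V)) r
    | refl => rfl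
    | symm _ _ _ ih => exact ih.symm
    | trans _ _ _ _ _ ih ih' => exact ih.trans ih'

end PatchMonad

end Pushforward

/-! ### Saturated supports and monadicity -/

section Support

open Opposite TopCat

namespace PatchMonad

open TopCat.Sheaf

section

variable {Y : TopCat.{u}}

lemma mem_support_iff {G : Sheaf (Type u) Y} {y : Y} :
    y ∈ support G ↔ ∃ U : Opens Y, y ∈ U ∧ Nonempty (G.obj.obj (op U)) := by
  refine ⟨fun ⟨α⟩ ↦ ?_, fun ⟨U, hU, ⟨s⟩⟩ ↦ ⟨G.presheaf.germ U y hU s⟩⟩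
  obtain ⟨U, hU, s, -⟩ := G.presheaf.exists_germ_eq α
  exact ⟨U, hU, ⟨s⟩⟩

lemma isOpen_support (G : Sheaf (Type u) Y) : IsOpen (support G) := by
  refine isOpen_iff_forall_mem_open.2 fun y hy ↦ ?_
  obtain ⟨U, hU, h⟩ := mem_support_iff.1 hy
  exact ⟨U, fun z hz ↦ mem_support_iff.2 ⟨U, hz, h⟩, U.isOpen, hU⟩

lemma support_subset_of_hom {F G : Sheaf (Type u) Y} (f : F ⟶ G) : support F ⊆ support G :=
  fun y ⟨α⟩ ↦ ⟨(Presheaf.stalkFunctor _ y).map f.hom α⟩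

lemma support_eq_of_epi {F G : Sheaf (Type u) Y} (f : F ⟶ G) [Epi f] :
    support F = support G := by
  refine (support_subset_of_hom f).antisymm fun y hy ↦ ?_
  obtain ⟨U, hU, ⟨t⟩⟩ := mem_support_iff.1 hy
  obtain ⟨V, -, ⟨s, -⟩, hV⟩ := (epi_iff f).1 inferInstance U t y hU
  exact mem_support_iff.2 ⟨V, hV, ⟨s⟩⟩

end

/-- Only non-emptiness of stalks matters, so a map each way suffices: sheafification is surjective
on stalks, and the unit transports sections of `F` to preimages. -/
lemma support_pullback {Y Z : TopCat.{u}} (f : Y ⟶ Z) (F : Sheaf (Type u) Z) :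
    support ((TopCat.Sheaf.pullback (Type u) f).obj F) = f ⁻¹' support F := by
  ext y
  constructor
  · intro hy
    have hy' := support_subset_of_hom ((pullbackIso (Type u) f).hom.app F) hy
    obtain ⟨α⟩ := hy'
    have h := (Presheaf.locally_surjective_iff_surjective_on_stalks
      (toSheafify (Opens.grothendieckTopology Y)
        ((TopCat.Presheaf.pullback (Type u) f).obj F.obj))).1
      (inferInstanceAs (CategoryTheory.Presheaf.IsLocallySurjective _ (toSheafify _ _))) y
    obtain ⟨β, -⟩ := h α
    exact ⟨Presheaf.stalkPullbackInv (Type u) f F.obj y β⟩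
  · intro hy
    obtain ⟨U, hU, ⟨s⟩⟩ := mem_support_iff.1 hy
    exact mem_support_iff.2 ⟨(Opens.map f).obj U, hU,
      ⟨((pullbackPushforwardAdjunction (Type u) f).unit.app F).hom.app (op U) s⟩⟩

variable (X : TopCat.{u}) [SpectralSpace X]

/-- The support of `F` is open in `X`, and open sets are upsets for specialisation. -/
lemma hasSaturatedSupport_pullback (F : Sheaf (Type u) X) :
    HasSaturatedSupport X ((TopCat.Sheaf.pullback (Type u) (patchMap X)).obj F) := by
  intro x y hxy hx
  rw [support_pullback] at hx ⊢
  obtain ⟨z, hz, rfl⟩ := mem_closure_iff.1 hxy _ (isOpen_support F) hx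
  exact hz

/-- Passing to a quotient does not change the support. Coequalisers of saturated sheaves are thus
computed among all sheaves on `Xᵖ`. -/
instance : (HasSaturatedSupport X).IsClosedUnderColimitsOfShape WalkingParallelPair where
  colimitsOfShape_le := by
    rintro G ⟨p⟩
    have : Epi (p.ι.app .one) := ⟨fun g h e ↦ p.isColimit.hom_ext fun j ↦ by
      cases j with
      | zero =>
        change p.ι.app .zero ≫ g = p.ι.app .zero ≫ h
        have w : p.diag.map .left ≫ p.ι.app .one = p.ι.app .zero := p.cocone.w .left
        rw [← w, Category.assoc, Category.assoc, e]
      | one => exact e⟩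
    intro x y hxy hx
    have h := support_eq_of_epi (p.ι.app .one)
    exact h.subset (p.prop_diag_obj .one x y hxy (h.superset hx))

variable {X}

/-- A point of the support of a sheaf with saturated support has a compact open neighbourhood in
`X` that is contained in the support. -/
lemma exists_map_patchMap_subset_support {G : Sheaf (Type u) (patchSpace X)}
    (hG : HasSaturatedSupport X G) {x : patchSpace X} (hx : x ∈ support G) :
    ∃ U : Opens X, IsCompact (U : Set X) ∧ x ∈ (Opens.map (patchMap X)).obj U ∧
      ((Opens.map (patchMap X)).obj U : Set (patchSpace X)) ⊆ support G := by
  let ι := {U : Opens X // IsCompact (U : Set X) ∧ toBase X x ∈ U}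
  have : Nonempty ι := ⟨⟨⊤, isCompact_univ, trivial⟩⟩
  -- The sets in this directed family intersect in the generisations of `x`, which saturation places
  -- in the open set `support G`.
  obtain ⟨⟨U, hU, hxU⟩, hUS⟩ := exists_subset_nhds_of_isCompact' (ι := ι)
    (V := fun U ↦ ((Opens.map (patchMap X)).obj U.1 : Set (patchSpace X)))
    (fun U V ↦ ⟨⟨U.1 ⊓ V.1, U.2.1.inter_of_isOpen V.2.1 U.1.isOpen V.1.isOpen, U.2.2, V.2.2⟩,
      fun _ h ↦ h.1, fun _ h ↦ h.2⟩)
    (fun U ↦ isCompact_map_patchMap X U.2.1)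
    (fun U ↦ (isClopen_map_patchMap X U.2.1).isClosed) (U := support G) (fun y hy ↦ by
      refine (isOpen_support G).mem_nhds (hG x y (mem_closure_iff.2 fun V hV hxV ↦ ?_) hx)
      obtain ⟨W, hWV, hxW, hW⟩ := exists_isCompact_le X (U := ⟨V, hV⟩) hxV
      exact ⟨_, hWV (Set.mem_iInter.1 hy ⟨W, hW, hxW⟩), rfl⟩)
  exact ⟨U, hU, hxU, hUS⟩

/-- On a small clopen neighbourhood of `x`, `t` can be overwritten by `s`; nothing needs to agree on
the boundary. -/
lemma _root_.TopCat.Sheaf.exists_modify {Y : TopCat.{u}}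
    (hY : IsTopologicalBasis {s : Set Y | IsClopen s}) (F : Sheaf (Type u) Y) {K V : Opens Y}
    (hV : V ≤ K) {x : Y} (hx : x ∈ V) (s : F.obj.obj (op V)) (t : F.obj.obj (op K)) :
    ∃ (W D : Opens Y) (hW : W ≤ V) (hD : D ≤ K) (r : F.obj.obj (op K)), x ∈ W ∧ K ≤ W ⊔ D ∧
      F.presheaf.res (hW.trans hV) r = F.presheaf.res hW s ∧
      F.presheaf.res hD r = F.presheaf.res hD t := by
  obtain ⟨W, hW, hxW, hWV⟩ := hY.exists_subset_of_mem_open hx V.isOpen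
  let W' : Opens Y := ⟨W, hW.isOpen⟩
  let D : Opens Y := ⟨K \ W, K.isOpen.sdiff hW.isClosed⟩
  have hWV' : W' ≤ V := hWV
  have hDK : D ≤ K := Set.sdiff_subset
  have hK : K ≤ W' ⊔ D := by
    intro y hy
    by_cases h : y ∈ W
    · exact Or.inl h
    · exact Or.inr ⟨hy, h⟩
  have hWD : Disjoint W' D := by
    rw [disjoint_iff]
    ext1
    exact Set.inter_sdiff_self _ _
  obtain ⟨r, h₁, h₂⟩ := F.exists_glue' hWD (hWV'.trans hV) hDK hK
    (F.presheaf.res hWV' s) (F.presheaf.res hDK t)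
  exact ⟨W', D, hWV', hDK, r, hxW, hK, h₁, h₂⟩

/-- The germs of a sheaf with saturated support come from sections over compact open subsets of
`X`. -/
lemma exists_germ_map_patchMap_eq {G : Sheaf (Type u) (patchSpace X)}
    (hG : HasSaturatedSupport X G) {x : patchSpace X} (α : G.presheaf.stalk x) :
    ∃ (U : Opens X) (hx : x ∈ (Opens.map (patchMap X)).obj U)
      (s : G.obj.obj (op ((Opens.map (patchMap X)).obj U))), G.presheaf.germ _ x hx s = α := by
  obtain ⟨U, hU, hxU, hUS⟩ := exists_map_patchMap_subset_support hG ⟨α⟩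
  obtain ⟨t⟩ := G.nonempty_of_nonempty_stalk (isTopologicalBasis_isClopen X)
    (isCompact_map_patchMap X hU) hUS
  obtain ⟨V, hVU, hxV, s, rfl⟩ := G.presheaf.exists_le_germ_eq α hxU
  obtain ⟨W, D, hW, hD, r, hxW, -, hr, -⟩ :=
    G.exists_modify (isTopologicalBasis_isClopen X) hVU hxV s t
  refine ⟨U, hxU, r, ?_⟩
  rw [← Presheaf.germ_res_eq _ (hW.trans hVU) hxW, hr, Presheaf.germ_res_eq]

instance directImage_reflectsIsomorphisms : (directImage X).ReflectsIsomorphisms where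
  reflects {G H} f hf := by
    have hbij (U : Opens X) :
        Function.Bijective (f.hom.hom.app (op ((Opens.map (patchMap X)).obj U))) := by
      have : IsIso (((Sheaf.forget (Type u) X ⋙ (evaluation _ _).obj (op U)).map
        ((directImage X).map f))) := inferInstance
      exact (isIso_iff_bijective _).1 this
    have (x : patchSpace X) : IsIso ((Presheaf.stalkFunctor (Type u) x).map f.hom.hom) := by
      rw [isIso_iff_bijective]
      constructor
      · intro α β hαβ
        obtain ⟨U, hxU, a, rfl⟩ := exists_germ_map_patchMap_eq G.property α
        obtain ⟨V, hVU, hxV, b, rfl⟩ := G.obj.presheaf.exists_le_germ_eq β hxU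
        rw [Presheaf.stalkFunctor_map_germ_apply, Presheaf.stalkFunctor_map_germ_apply] at hαβ
        obtain ⟨N, hxN, hNU, hNV, e⟩ := Presheaf.exists_res_eq_of_germ_eq _ _ _ hαβ
        -- Splicing `b` into `a` near `x` gives `r` with the same image as `a`; injectivity over the
        -- preimage of `U` forces `r = a`, so the germs agree.
        obtain ⟨W, D, hW, hD, r, hxW, hK, hr, hr'⟩ :=
          G.obj.exists_modify (isTopologicalBasis_isClopen X) hNU hxN
            (G.obj.presheaf.res hNV b) a
        have : r = a := (hbij U).1 <| H.obj.eq_of_sup (hW.trans hNU) hD hK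
          (by
            have e' := congr_arg (H.obj.presheaf.res hW) e
            rw [Presheaf.res_res, Presheaf.res_res] at e'
            rw [← Presheaf.app_res, hr, Presheaf.res_res, Presheaf.app_res, e'])
          (by rw [← Presheaf.app_res, hr', Presheaf.app_res])
        rw [← this, ← Presheaf.germ_res_eq _ (hW.trans hNU) hxW, hr, Presheaf.germ_res_eq,
          Presheaf.germ_res_eq]
      · intro β
        obtain ⟨U, hxU, t, rfl⟩ := exists_germ_map_patchMap_eq H.property β
        obtain ⟨s, rfl⟩ := (hbij U).2 t
        exact ⟨G.obj.presheaf.germ _ x hxU s, Presheaf.stalkFunctor_map_germ_apply _ _ _ _ _⟩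
    have : IsIso f.hom := Presheaf.isIso_of_stalkFunctor_map_iso f.hom
    have : IsIso ((HasSaturatedSupport X).ι.map f) := this
    exact isIso_of_reflects_iso f (HasSaturatedSupport X).ι

variable (X)

/-- The adjunction between `φ^*` and the restriction of `φ_*` to sheaves with saturated support. -/
noncomputable def saturatedAdjunction :
    (HasSaturatedSupport X).lift (TopCat.Sheaf.pullback (Type u) (patchMap X))
      (hasSaturatedSupport_pullback X) ⊣ directImage X where
  unit := { app F := (patchAdjunction X).unit.app F
            naturality _ _ f := (patchAdjunction X).unit.naturality f }
  counit := { app G := ObjectProperty.homMk ((patchAdjunction X).counit.app G.obj)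
              naturality _ _ f := by
                ext1
                exact (patchAdjunction X).counit.naturality f.hom }
  left_triangle_components F := by
    ext1
    exact (patchAdjunction X).left_triangle_components F
  right_triangle_components G := (patchAdjunction X).right_triangle_components G.obj

instance : Monad.PreservesColimitOfIsReflexivePair (directImage X) where
  out G H f g _ := by
    have := Monad.preservesColimit_of_isReflexivePair
      (TopCat.Sheaf.pushforward (Type u) (patchMap X))
      (parallelPair f g ⋙ (HasSaturatedSupport X).ι)
      (IsReflexivePair.map f g (HasSaturatedSupport X).ι)
    exact inferInstanceAs (PreservesColimit (parallelPair f g)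
      ((HasSaturatedSupport X).ι ⋙ TopCat.Sheaf.pushforward (Type u) (patchMap X)))

/-- The restriction of `φ_*` to sheaves with saturated support is monadic. -/
noncomputable abbrev monadicDirectImage : MonadicRightAdjoint (directImage X) :=
  Monad.monadicOfHasPreservesReflexiveCoequalizersOfReflectsIsomorphisms (saturatedAdjunction X)

/-- The restricted adjunction has the unit and counit of `φ^* ⊣ φ_*`, so its monad and comparison
functor are the required ones by definition. -/
lemma isEquivalence_comparison : (comparison X).IsEquivalence :=
  (monadicDirectImage X).eqv

end PatchMonad

end Support

/-! ### Barr exactness of the category of algebras -/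

section Exact

namespace CategoryTheory

variable {C : Type u} [Category.{v} C]

lemma EquivalenceRelation.isReflexivePair {R A : C} {p₁ p₂ : R ⟶ A}
    (e : EquivalenceRelation p₁ p₂) : IsReflexivePair p₁ p₂ :=
  .mk' e.r e.reflexivity₁ e.reflexivity₂

lemma JointlyMono₂.map_of_adjunction {D : Type*} [Category* D] {F : C ⥤ D} {G : D ⥤ C}
    (adj : F ⊣ G) {R A B : D} (p₁ : R ⟶ A) (p₂ : R ⟶ B) [h : JointlyMono₂ p₁ p₂] :
    JointlyMono₂ (G.map p₁) (G.map p₂) where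
  right_cancellation Y f g h₁ h₂ := by
    refine (adj.homEquiv _ _).symm.injective (h.right_cancellation _ _ ?_ ?_)
    · rw [← adj.homEquiv_naturality_right_symm, h₁, adj.homEquiv_naturality_right_symm]
    · rw [← adj.homEquiv_naturality_right_symm, h₂, adj.homEquiv_naturality_right_symm]

/-- The image of an equivalence relation under a right adjoint. -/
noncomputable def EquivalenceRelation.mapOfAdjunction {D : Type*} [Category* D] {F : C ⥤ D}
    {G : D ⥤ C} (adj : F ⊣ G) [PreservesLimitsOfShape WalkingCospan G] {R A : D}
    {p₁ p₂ : R ⟶ A} (e : EquivalenceRelation p₁ p₂) :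
    EquivalenceRelation (G.map p₁) (G.map p₂) :=
  have := e.toJointlyMono₂
  have := JointlyMono₂.map_of_adjunction adj p₁ p₂
  { __ := e.toReflexiveRelation.map G
    __ := e.toSymmetricRelation.map G
    __ := e.toTransitiveRelation.map G }

namespace Monad

variable (T : Monad C) [PreservesColimitOfIsReflexivePair T.toFunctor]

/-- If a monad preserves reflexive coequalizers, its algebras have reflexive coequalizers and they
are created by the forgetful functor. -/
noncomputable abbrev forgetCreatesColimitOfIsReflexivePair {A B : T.Algebra} (f g : A ⟶ B)
    [IsReflexivePair f g] : CreatesColimit (parallelPair f g) T.forget :=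
  have := preservesColimit_of_isReflexivePair T.toFunctor (parallelPair f g ⋙ T.forget)
    (IsReflexivePair.map f g T.forget)
  -- Creation needs the coequaliser preserved by `T` twice: the second time for associativity of the
  -- induced structure.
  have := preservesColimit_of_isReflexivePair T.toFunctor
    ((parallelPair f g ⋙ T.forget) ⋙ T.toFunctor)
    (IsReflexivePair.map f g (T.forget ⋙ T.toFunctor))
  inferInstance

variable [HasCoequalizers C]

lemma hasCoequalizer_of_isReflexivePair {A B : T.Algebra} (f g : A ⟶ B) [IsReflexivePair f g] :
    HasCoequalizer f g :=
  have := T.forgetCreatesColimitOfIsReflexivePair f g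
  have : HasColimit (parallelPair f g ⋙ T.forget) := inferInstance
  hasColimit_of_created _ T.forget

lemma forget_preservesColimit_of_isReflexivePair {A B : T.Algebra} (f g : A ⟶ B)
    [IsReflexivePair f g] : PreservesColimit (parallelPair f g) T.forget :=
  have := T.forgetCreatesColimitOfIsReflexivePair f g
  have : HasColimit (parallelPair f g ⋙ T.forget) := inferInstance
  inferInstance

variable [HasPullbacks C] [IsRegularEpiCategory C]

/-- If a monad preserves reflexive coequalizers, a morphism of algebras is a regular epimorphism if
and only if the underlying morphism is an epimorphism. -/
lemma isRegularEpi_iff_epi_forget_map {A B : T.Algebra} (f : A ⟶ B) :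
    IsRegularEpi f ↔ Epi (T.forget.map f) := by
  have : HasPullbacks T.Algebra :=
    hasLimitsOfShape_of_hasLimitsOfShape_createsLimitsOfShape T.forget
  -- The diagonal makes the kernel pair reflexive, so its coequaliser is within reach of the
  -- hypothesis on `T`.
  have k : IsKernelPair f (pullback.fst f f) (pullback.snd f f) := .of_hasPullback f
  have : IsReflexivePair (pullback.fst f f) (pullback.snd f f) :=
    .mk' (pullback.lift (𝟙 _) (𝟙 _) rfl) (pullback.lift_fst _ _ _) (pullback.lift_snd _ _ _)
  constructor
  · intro _
    have := T.forget_preservesColimit_of_isReflexivePair (pullback.fst f f) (pullback.snd f f)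
    exact Cofork.IsColimit.epi (isColimitCoforkMapOfIsColimit T.forget _ k.toCoequalizer')
  · intro _
    have := T.forgetCreatesColimitOfIsReflexivePair (pullback.fst f f) (pullback.snd f f)
    have : IsRegularEpi (T.forget.map f) := IsRegularEpiCategory.regularEpiOfEpi _
    have k' : IsKernelPair (T.forget.map f) _ _ := IsPullback.map T.forget k
    exact ⟨⟨_, _, _, _, isColimitOfIsColimitCoforkMap T.forget k.w k'.toCoequalizer'⟩⟩

/-- If a monad on an exact category preserves reflexive coequalizers, its category of algebras is
exact. -/
theorem isBarrExact_algebra [HasFiniteLimits C]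
    (effective : ∀ {R A : C} {p₁ p₂ : R ⟶ A}, EquivalenceRelation p₁ p₂ →
      ∀ {Q : C} {q : A ⟶ Q} {w : p₁ ≫ q = p₂ ≫ q}, IsColimit (Cofork.ofπ q w) →
        IsKernelPair q p₁ p₂)
    [(MorphismProperty.epimorphisms C).IsStableUnderBaseChange] : IsBarrExact T.Algebra where
  hasFiniteLimits := ⟨fun _ _ _ ↦
    hasLimitsOfShape_of_hasLimitsOfShape_createsLimitsOfShape T.forget⟩
  effective {R A} p₁ p₂ h := by
    obtain ⟨e⟩ := h.nonempty_equivalenceRelation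
    have := e.isReflexivePair
    have := T.hasCoequalizer_of_isReflexivePair p₁ p₂
    have := T.forget_preservesColimit_of_isReflexivePair p₁ p₂
    refine ⟨_, coequalizer.π p₁ p₂, coequalizer.condition p₁ p₂,
      ⟨coequalizerIsCoequalizer p₁ p₂⟩, ?_⟩
    exact IsPullback.of_map T.forget (coequalizer.condition p₁ p₂) <|
      effective (e.mapOfAdjunction T.adj) <|
        isColimitCoforkMapOfIsColimit T.forget _ (coequalizerIsCoequalizer p₁ p₂)
  regularEpi_stable := ⟨fun {A B B' S f g f' g'} sq hg ↦ by
    rw [MorphismProperty.regularEpi_iff, isRegularEpi_iff_epi_forget_map] at hg ⊢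
    exact MorphismProperty.IsStableUnderBaseChange.of_isPullback
      (P := MorphismProperty.epimorphisms C) (sq.map T.forget) hg⟩

end Monad

end CategoryTheory

namespace TopCat.Sheaf

open Opposite

variable {Y : TopCat.{u}}

/-- The functor of sections over an open set. -/
noncomputable abbrev sections (U : Opens Y) : Sheaf (Type u) Y ⥤ Type u :=
  Sheaf.forget (Type u) Y ⋙ (evaluation _ _).obj (op U)

lemma isPullback_sections {P A B S : Sheaf (Type u) Y} {f : P ⟶ A} {g : P ⟶ B} {h : A ⟶ S}
    {k : B ⟶ S} (sq : IsPullback f g h k) (U : Opens Y) :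
    IsPullback (f.hom.app (op U)) (g.hom.app (op U)) (h.hom.app (op U)) (k.hom.app (op U)) :=
  have : PreservesLimitsOfShape WalkingCospan (Sheaf.forget (Type u) Y) := inferInstance
  have : PreservesLimitsOfShape WalkingCospan
      ((evaluation (Opens Y)ᵒᵖ (Type u)).obj (op U)) := inferInstance
  have : PreservesLimitsOfShape WalkingCospan (sections (Y := Y) U) :=
    comp_preservesLimitsOfShape _ _
  sq.map (sections U)

instance : (MorphismProperty.epimorphisms (Sheaf (Type u) Y)).IsStableUnderBaseChange where
  of_isPullback {A B B' S f g f' g'} sq hg := by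
    have hg' := (epi_iff g).1 hg
    refine (epi_iff g').2 fun U t x hx ↦ ?_
    obtain ⟨V, hV, ⟨s, hs⟩, hxV⟩ := hg' U (f.hom.app (op U) t) x hx
    obtain ⟨r, -, hr⟩ := Types.exists_of_isPullback (isPullback_sections sq V) s
      (A.presheaf.res hV t) (by rw [hs, Presheaf.app_res])
    exact ⟨V, hV, ⟨r, hr⟩, hxV⟩

lemma equivalence_rel {R A : Sheaf (Type u) Y} {p₁ p₂ : R ⟶ A} (e : EquivalenceRelation p₁ p₂)
    (U : Opens Y) : Equivalence (Rel p₁ p₂ U) where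
  refl a := ⟨e.r.hom.app (op U) a,
    ConcreteCategory.congr_hom (congr_app (congr_arg (·.hom) e.reflexivity₁) (op U)) a,
    ConcreteCategory.congr_hom (congr_app (congr_arg (·.hom) e.reflexivity₂) (op U)) a⟩
  symm := by
    rintro _ _ ⟨r, rfl, rfl⟩
    exact ⟨e.s.hom.app (op U) r,
      ConcreteCategory.congr_hom (congr_app (congr_arg (·.hom) e.symmetry₁) (op U)) r,
      ConcreteCategory.congr_hom (congr_app (congr_arg (·.hom) e.symmetry₂) (op U)) r⟩
  trans := by
    rintro _ _ _ ⟨r, rfl, rfl⟩ ⟨r', h, rfl⟩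
    have sq : IsPullback e.c.fst e.c.snd p₂ p₁ := ⟨⟨e.c.condition⟩, ⟨.ofIsoLimit e.isLimit e.c.eta⟩⟩
    obtain ⟨c, rfl, rfl⟩ := Types.exists_of_isPullback (isPullback_sections sq U) r r' h.symm
    exact ⟨e.t.hom.app (op U) c,
      ConcreteCategory.congr_hom (congr_app (congr_arg (·.hom) e.transitivity₁) (op U)) c,
      ConcreteCategory.congr_hom (congr_app (congr_arg (·.hom) e.transitivity₂) (op U)) c⟩

/-- Equivalence relations in a category of sheaves of sets are effective. -/
lemma isKernelPair_of_equivalenceRelation {R A : Sheaf (Type u) Y} {p₁ p₂ : R ⟶ A}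
    (e : EquivalenceRelation p₁ p₂) {Q : Sheaf (Type u) Y} {q : A ⟶ Q} {w : p₁ ≫ q = p₂ ≫ q}
    (hq : IsColimit (Cofork.ofπ q w)) : IsKernelPair q p₁ p₂ := by
  have k : IsKernelPair q (pullback.fst q q) (pullback.snd q q) := .of_hasPullback q
  let l : R ⟶ Limits.pullback q q := pullback.lift p₁ p₂ w
  have h₁ : l ≫ pullback.fst q q = p₁ := pullback.lift_fst _ _ _
  have h₂ : l ≫ pullback.snd q q = p₂ := pullback.lift_snd _ _ _
  have : Mono l := ⟨fun a b h ↦ e.right_cancellation a b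
    (by rw [← h₁, ← Category.assoc, h, Category.assoc])
    (by rw [← h₂, ← Category.assoc, h, Category.assoc])⟩
  -- Local chains shorten to a single link, because `R` induces an equivalence relation on sections.
  have : Epi l := (epi_iff l).2 fun U t x hx ↦ by
    obtain ⟨V, hxV, hV, h⟩ := exists_eqvGen_of_isColimit_cofork hq
      (ConcreteCategory.congr_hom (congr_app (congr_arg (·.hom) k.w) (op U)) t) hx
    rw [(equivalence_rel e V).eqvGen_iff] at h
    obtain ⟨r, hr₁, hr₂⟩ := h
    refine ⟨V, hV, ⟨r, Types.ext_of_isPullback (isPullback_sections k V) ?_ ?_⟩, hxV⟩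
    · rw [← comp_app_apply, h₁]
      exact hr₁.trans (Presheaf.app_res _ _ _).symm
    · rw [← comp_app_apply, h₂]
      exact hr₂.trans (Presheaf.app_res _ _ _).symm
  have : IsIso l := isIso_of_mono_of_epi l
  exact k.of_iso (asIso l).symm (Iso.refl _) (Iso.refl _) (Iso.refl _) (by simp [← h₁])
    (by simp [← h₂]) (by simp) (by simp)

end TopCat.Sheaf

namespace PatchMonad

variable (X : TopCat.{u}) [SpectralSpace X]

/-- The left adjoint `φ^*` preserves all colimits and sends reflexive pairs to reflexive pairs,
which `φ_*` handles. -/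
instance : Monad.PreservesColimitOfIsReflexivePair (patchMonad X).toFunctor where
  out F G f g _ := by
    have : PreservesColimitsOfSize.{0, 0} (TopCat.Sheaf.pullback (Type u) (patchMap X)) :=
      (patchAdjunction X).leftAdjoint_preservesColimits
    have := Monad.preservesColimit_of_isReflexivePair
      (TopCat.Sheaf.pushforward (Type u) (patchMap X))
      (parallelPair f g ⋙ TopCat.Sheaf.pullback (Type u) (patchMap X))
      (IsReflexivePair.map f g (TopCat.Sheaf.pullback (Type u) (patchMap X)))
    exact inferInstanceAs (PreservesColimit (parallelPair f g)
      (TopCat.Sheaf.pullback (Type u) (patchMap X) ⋙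
        TopCat.Sheaf.pushforward (Type u) (patchMap X)))

end PatchMonad

end Exact

theorem mainTheorem3 (X : TopCat.{u}) [SpectralSpace X] :
    (∀ F : TopCat.Sheaf (Type u) X, PatchMonad.HasSaturatedSupport X
      ((TopCat.Sheaf.pullback (Type u) (PatchMonad.patchMap X)).obj F)) ∧
    Nonempty (MonadicRightAdjoint (PatchMonad.directImage X)) ∧
    (PatchMonad.comparison X).IsEquivalence ∧
    IsBarrExact (PatchMonad.patchMonad X).Algebra :=
  ⟨PatchMonad.hasSaturatedSupport_pullback X, ⟨PatchMonad.monadicDirectImage X⟩,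
    PatchMonad.isEquivalence_comparison X,
    Monad.isBarrExact_algebra _ TopCat.Sheaf.isKernelPair_of_equivalenceRelation⟩
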